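/- **Setting.** There are $S\ge 1$ base stations (BSs) with $N$ antennas each, $K$ users, channels $\mathbf h_{s,k}\in\mathbb C^N$, $\mathbf H_{s,k}=\mathbf h_{s,k}\mathbf h_{s,k}^H$, noise powers $\sigma_{\mathrm c,k}^2>0$, $\sigma_{\mathrm r,s}^2>0$, SINR thresholds $\Gamma_k>0$, a power budget $P$, a threshold $\epsilon$, a number of samples $L$, a penalty factor $\mu\in\mathbb R$, reals $a^{(t)}_{s,k}$, and gains $\alpha_{s,s'}\in\mathbb C$. The angles $\theta_{\mathrm r,s},\theta_{\mathrm t,s}$ and the delays $\tau_{s,s'}$ are real functions of a target location in $\mathbb R^2$, differentiable at the given point $\mathbf p=(p_1,p_2)$; a superscript $(i)$ with a dot denotes $\partial/\partial p_i$ at $\mathbf p$. The BS selection $b_s\in[0,1]$ (in particular $b_s\in\{0,1\}$) is fixed, with $\sum_s(1-b_s)=1$. With $\mathbf a(\theta)=[1,e^{-j\pi\sin\theta},\dots,e^{-j(N-1)\pi\sin\theta}]^T$ put $\mathbf G_{s,s'}=\mathbf a(\theta_{\mathrm r,s})\mathbf a(\theta_{\mathrm t,s'})^H$, $\dot{\mathbf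 G}^{(i)}_{s,s'}=\dot{\mathbf a}^{(i)}(\theta_{\mathrm r,s})\mathbf a(\theta_{\mathrm t,s'})^H+\mathbf a(\theta_{\mathrm r,s})[\dot{\mathbf a}^{(i)}(\theta_{\mathrm t,s'})]^H$ and $\tilde{\mathbf G}^{(i)}_{s,s'}=\dot{\mathbf G}^{(i)}_{s,s'}-\dot\tau^{(i)}_{s,s'}\mathbf G_{s,s'}$. **Problem.** The variables are Hermitian $N\times N$ matrices $\mathbf W_{s,k},\widetilde{\mathbf W}_{s,k},\mathbf R_s$, a Hermitian $2\times2$ matrix $\mathbf J$, and reals $a_{s,k}$. Put $\mathbf Q_s=\sum_k\widetilde{\mathbf W}_{s,k}+\mathbf R_s$. For each $s$, with $s'_1<\dots<s'_{S-1}$ the BSs other than $s$, let $$(\mathbf F^{(s)}_{\mathbf p\mathbf p})_{ij}=\tfrac{2L}{\sigma_{\mathrm r,s}^2}\Re\,\mathrm{tr}\sum_{s'\ne s}|\alpha_{s,s'}|^2\tilde{\mathbf G}^{(j)}_{s,s'}\mathbf Q_{s'}[\tilde{\mathbf G}^{(i)}_{s,s'}]^H,\quad \mathbf F^{(s)}_{\mathbf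 p\boldsymbol\alpha}=\tfrac{2L}{\sigma_{\mathrm r,s}^2}\Re\{[1,j]\otimes\mathbf D^{(s)}\},\quad \mathbf F^{(s)}_{\boldsymbol\alpha\boldsymbol\alpha}=\tfrac{2L}{\sigma_{\mathrm r,s}^2}\mathbf I_2\otimes\mathbf E^{(s)},$$ where $\mathbf D^{(s)}_{i,m}=\alpha^*_{s,s'_m}\mathrm{tr}(\mathbf G_{s,s'_m}\mathbf Q_{s'_m}[\tilde{\mathbf G}^{(i)}_{s,s'_m}]^H)$ and $\mathbf E^{(s)}$ is diagonal with entries $\mathrm{tr}(\mathbf G_{s,s'_m}\mathbf Q_{s'_m}\mathbf G_{s,s'_m}^H)$. The subproblem is to minimize $$\sum_{s,k}\mathrm{tr}(\widetilde{\mathbf W}_{s,k})+\sum_s b_s\mathrm{tr}(\mathbf R_s)+\mu\sum_{s,k}\big((1-2a^{(t)}_{s,k})a_{s,k}+(a^{(t)}_{s,k})^2\big)$$ subject to $\mathbf W_{s,k}\succeq\mathbf 0$, $\mathbf R_s\succeq\mathbf 0$ and, for all $s,k$, - C1: $\sum_k\mathrm{tr}(\widetilde{\mathbf W}_{s,k})+b_s\mathrm{tr}(\mathbf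 R_s)\le P$; - C2a, C2b: $\mathbf J\succeq\mathbf 0$ is invertible and $\mathrm{tr}(\mathbf J^{-1})\le\epsilon$; - C2c: $\sum_s(1-b_s)\begin{bmatrix}\mathbf F^{(s)}_{\mathbf p\mathbf p}-\mathbf J&\mathbf F^{(s)}_{\mathbf p\boldsymbol\alpha}\\ [\mathbf F^{(s)}_{\mathbf p\boldsymbol\alpha}]^T&\mathbf F^{(s)}_{\boldsymbol\alpha\boldsymbol\alpha}\end{bmatrix}\succeq\mathbf 0$; - C3: $\frac1{\Gamma_k}\sum_s\mathrm{tr}(\mathbf H_{s,k}\widetilde{\mathbf W}_{s,k})-\sum_sb_s\mathrm{tr}(\mathbf H_{s,k}\mathbf R_s)-\sum_s\sum_{k'\ne k}\mathrm{tr}(\mathbf H_{s,k}\widetilde{\mathbf W}_{s,k'})\ge\sigma_{\mathrm c,k}^2$; - C4: $\sum_sa_{s,k}=1$; C6: $a_{s,k}\le b_s$; C7: $a_{s,k}\in\mathcal A$, where either $\mathcal A=\{0,1\}$ or $\mathcal A=[0,1]$; - C9: $\mathrm{rank}(\mathbf W_{s,k})\le1$; - C10: $\widetilde{\mathbf W}_{s,k}\preceq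 a_{s,k}P\mathbf I$, $\ \widetilde{\mathbf W}_{s,k}\succeq\mathbf W_{s,k}-(1-a_{s,k})P\mathbf I$, $\ \widetilde{\mathbf W}_{s,k}\preceq\mathbf W_{s,k}$, $\ \widetilde{\mathbf W}_{s,k}\succeq\mathbf 0$. **Theorem 1.** For either choice of $\mathcal A$, if the relaxed problem (all constraints except C9) is feasible, then it has an optimal solution with $\mathrm{rank}(\mathbf W_{s,k})=1$ for all $s,k$. In particular this solution is also optimal for the problem with C9, so the relaxation is tight. -/

import Mathlib

open scoped Matrix Kronecker ComplexOrder

noncomputable section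

namespace ISAC

/-- The given data of the beamforming subproblem, for `M + 1` base stations (BSs) with `N`
antennas each and `K` single-antenna users. The angles and delays are functions of the planar
target location, so that every geometry of the network is covered. -/
structure Network (M K N : ℕ) where
  /-- channel `h_{s,k}` from BS `s` to user `k` -/
  h : Fin (M + 1) → Fin K → Fin N → ℂ
  /-- noise standard deviation at user `k` -/
  σc : Fin K → ℝ
  /-- noise standard deviation at BS `s` when receiving -/
  σr : Fin (M + 1) → ℝ
  /-- SINR threshold of user `k` -/
  Γ : Fin K → ℝ
  /-- power budget of each BS -/
  P : ℝ
  /-- threshold for the Cramér-Rao bound -/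
  ε : ℝ
  /-- number of radar samples -/
  L : ℕ
  /-- `α s s'`: complex gain of the link from BS `s'` via the target to BS `s` -/
  α : Fin (M + 1) → Fin (M + 1) → ℂ
  /-- target location -/
  p : Fin 2 → ℝ
  /-- angle of arrival at BS `s`, as a function of the target location -/
  θr : Fin (M + 1) → (Fin 2 → ℝ) → ℝ
  /-- angle of departure at BS `s`, as a function of the target location -/
  θt : Fin (M + 1) → (Fin 2 → ℝ) → ℝ
  /-- `τ s s'`: delay from BS `s'` via the target to BS `s`, as a function of the location -/
  τ : Fin (M + 1) → Fin (M + 1) → (Fin 2 → ℝ) → ℝ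
  /-- the fixed BS selection: `b s = 1` transmitting, `b s = 0` receiving -/
  b : Fin (M + 1) → ℝ
  /-- penalty factor -/
  μ : ℝ
  /-- association `a^{(t)}` of the previous iteration -/
  aPrev : Fin (M + 1) → Fin K → ℝ

/-- The optimization variables `W_{s,k}`, `W̃_{s,k}`, `R_s`, `J`, `a_{s,k}`. -/
structure Vars (M K N : ℕ) where
  W : Fin (M + 1) → Fin K → Matrix (Fin N) (Fin N) ℂ
  Wt : Fin (M + 1) → Fin K → Matrix (Fin N) (Fin N) ℂ
  R : Fin (M + 1) → Matrix (Fin N) (Fin N) ℂ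
  J : Matrix (Fin 2) (Fin 2) ℂ
  a : Fin (M + 1) → Fin K → ℝ

/-- Steering vector `[1, e^{-jπ sin θ}, …, e^{-j(N-1)π sin θ}]` of a uniform linear array. -/
def steering (N : ℕ) (θ : ℝ) : Fin N → ℂ :=
  fun n => Complex.exp (-(Complex.I * (n : ℕ) * Real.pi * Real.sin θ))

/-- Derivative of the steering vector `a(θ(q))` with respect to the coordinate `q_i`, at `q = p`. -/
def steeringDeriv (N : ℕ) (θ : (Fin 2 → ℝ) → ℝ) (p : Fin 2 → ℝ) (i : Fin 2) : Fin N → ℂ :=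
  fun n => lineDeriv ℝ (fun q => steering N (θ q) n) p (Pi.single i 1)

namespace Network

variable {M K N : ℕ} (net : Network M K N)

/-- `H_{s,k} = h_{s,k} h_{s,k}^H`. -/
def H (s : Fin (M + 1)) (k : Fin K) : Matrix (Fin N) (Fin N) ℂ :=
  Matrix.vecMulVec (net.h s k) (star (net.h s k))

/-- Target response matrix `G_{s,s'} = a(θ_{r,s}) a(θ_{t,s'})^H`. -/
def G (s s' : Fin (M + 1)) : Matrix (Fin N) (Fin N) ℂ :=
  Matrix.vecMulVec (steering N (net.θr s net.p)) (star (steering N (net.θt s' net.p)))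

/-- The derivative of `G_{s,s'}` with respect to `p_i`. -/
def Gdot (i : Fin 2) (s s' : Fin (M + 1)) : Matrix (Fin N) (Fin N) ℂ :=
  Matrix.vecMulVec (steeringDeriv N (net.θr s) net.p i) (star (steering N (net.θt s' net.p))) +
  Matrix.vecMulVec (steering N (net.θr s net.p)) (star (steeringDeriv N (net.θt s') net.p i))

/-- `G̃^{(i)}_{s,s'} = Ġ^{(i)}_{s,s'} - τ̇^{(i)}_{s,s'} G_{s,s'}`. -/
def Gtilde (i : Fin 2) (s s' : Fin (M + 1)) : Matrix (Fin N) (Fin N) ℂ :=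
  net.Gdot i s s' - ((lineDeriv ℝ (net.τ s s') net.p (Pi.single i 1) : ℝ) : ℂ) • net.G s s'

/-- Transmit covariance `∑_k W̃_{s,k} + R_s` of a transmitting BS. -/
def cov (x : Vars M K N) (s : Fin (M + 1)) : Matrix (Fin N) (Fin N) ℂ :=
  ∑ k, x.Wt s k + x.R s

/-- The location block of the Fisher information matrix when BS `s` receives. As `m` runs over
`Fin M`, `s.succAbove m` runs in increasing order over the BSs other than `s`. -/
def Fpp (x : Vars M K N) (s : Fin (M + 1)) : Matrix (Fin 2) (Fin 2) ℝ :=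
  Matrix.of fun i j => 2 * (net.L : ℝ) / net.σr s ^ 2 *
    (Matrix.trace (∑ m : Fin M, ((‖net.α s (s.succAbove m)‖ ^ 2 : ℝ) : ℂ) •
      (net.Gtilde j s (s.succAbove m) * cov x (s.succAbove m) *
        (net.Gtilde i s (s.succAbove m))ᴴ))).re

/-- The entries `D_{i,s'}`. -/
def D (x : Vars M K N) (s : Fin (M + 1)) : Matrix (Fin 2) (Fin M) ℂ :=
  Matrix.of fun i m => star (net.α s (s.succAbove m)) *
    Matrix.trace (net.G s (s.succAbove m) * cov x (s.succAbove m) *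
      (net.Gtilde i s (s.succAbove m))ᴴ)

/-- The location/gain block `(2L/σ²) Re([1, j] ⊗ D)`; in the column index `(c, m)`, `c = 0` stands
for the real and `c = 1` for the imaginary part of the gain. -/
def Fpα (x : Vars M K N) (s : Fin (M + 1)) : Matrix (Fin 2) (Fin 2 × Fin M) ℝ :=
  Matrix.of fun i cm => 2 * (net.L : ℝ) / net.σr s ^ 2 *
    ((![1, Complex.I] : Fin 2 → ℂ) cm.1 * net.D x s i cm.2).re

/-- The gain block `(2L/σ²) I₂ ⊗ E` with `E` diagonal (its entries are real). -/
def Fαα (x : Vars M K N) (s : Fin (M + 1)) : Matrix (Fin 2 × Fin M) (Fin 2 × Fin M) ℝ :=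
  (2 * (net.L : ℝ) / net.σr s ^ 2) • ((1 : Matrix (Fin 2) (Fin 2) ℝ) ⊗ₖ
    Matrix.diagonal fun m : Fin M =>
      (Matrix.trace (net.G s (s.succAbove m) * cov x (s.succAbove m) *
        (net.G s (s.succAbove m))ᴴ)).re)

/-- The block matrix of the Schur-complement form of the Cramér-Rao constraint. -/
def crlbBlock (x : Vars M K N) (s : Fin (M + 1)) :
    Matrix (Fin 2 ⊕ (Fin 2 × Fin M)) (Fin 2 ⊕ (Fin 2 × Fin M)) ℂ :=
  Matrix.fromBlocks ((net.Fpp x s).map Complex.ofReal - x.J) ((net.Fpα x s).map Complex.ofReal)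
    ((net.Fpα x s)ᵀ.map Complex.ofReal) ((net.Fαα x s).map Complex.ofReal)

/-- Feasibility for the subproblem without the rank constraint. The set `𝒜` is the range allowed
for the association variables: `{0, 1}`, or its continuous relaxation `[0, 1]`. -/
structure RelaxedFeasible (𝒜 : Set ℝ) (x : Vars M K N) : Prop where
  W_psd : ∀ s k, (x.W s k).PosSemidef
  R_psd : ∀ s, (x.R s).PosSemidef
  C1 : ∀ s, ∑ k, (x.Wt s k).trace.re + net.b s * (x.R s).trace.re ≤ net.P
  C2a : IsUnit x.J.det ∧ (x.J⁻¹).trace.re ≤ net.ε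
  C2b : x.J.PosSemidef
  C2c : (∑ s, ((1 - net.b s : ℝ) : ℂ) • net.crlbBlock x s).PosSemidef
  C3 : ∀ k, net.σc k ^ 2 ≤ 1 / net.Γ k * ∑ s, (net.H s k * x.Wt s k).trace.re
      - ∑ s, net.b s * (net.H s k * x.R s).trace.re
      - ∑ s, ∑ k' ∈ Finset.univ.erase k, (net.H s k * x.Wt s k').trace.re
  C4 : ∀ k, ∑ s, x.a s k = 1
  C6 : ∀ s k, x.a s k ≤ net.b s
  C7 : ∀ s k, x.a s k ∈ 𝒜
  C10a : ∀ s k, (((x.a s k * net.P : ℝ) : ℂ) • (1 : Matrix (Fin N) (Fin N) ℂ)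
      - x.Wt s k).PosSemidef
  C10b : ∀ s k, (x.Wt s k - (x.W s k
      - (((1 - x.a s k) * net.P : ℝ) : ℂ) • (1 : Matrix (Fin N) (Fin N) ℂ))).PosSemidef
  C10c : ∀ s k, (x.W s k - x.Wt s k).PosSemidef
  C10d : ∀ s k, (x.Wt s k).PosSemidef

/-- Feasible set of the rank-relaxed subproblem. -/
def relaxedSet (𝒜 : Set ℝ) : Set (Vars M K N) := {x | net.RelaxedFeasible 𝒜 x}

/-- Feasible set of the subproblem with the rank constraint `rank W_{s,k} ≤ 1`. -/
def rankSet (𝒜 : Set ℝ) : Set (Vars M K N) :=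
  {x | net.RelaxedFeasible 𝒜 x ∧ ∀ s k, (x.W s k).rank ≤ 1}

/-- The penalized transmit power. -/
def objective (x : Vars M K N) : ℝ :=
  ∑ s, ∑ k, (x.Wt s k).trace.re + ∑ s, net.b s * (x.R s).trace.re
    + net.μ * ∑ s, ∑ k, ((1 - 2 * net.aPrev s k) * x.a s k + net.aPrev s k ^ 2)

end Network

end ISAC

end

namespace Matrix

variable {n : Type*} [Fintype n]

theorem PosSemidef.trace_re_nonneg {A : Matrix n n ℂ} (hA : A.PosSemidef) : 0 ≤ A.trace.re :=
  (Complex.le_def.1 hA.trace_nonneg).1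

theorem trace_vecMulVec_self_star_mul (h : n → ℂ) (A : Matrix n n ℂ) :
    (vecMulVec h (star h) * A).trace = star h ⬝ᵥ A *ᵥ h := by
  rw [trace_mul_comm, mul_vecMulVec, trace_vecMulVec, dotProduct_comm]

theorem PosSemidef.trace_vecMulVec_mul_re_nonneg {A : Matrix n n ℂ} (hA : A.PosSemidef)
    (h : n → ℂ) : 0 ≤ (vecMulVec h (star h) * A).trace.re := by
  rw [trace_vecMulVec_self_star_mul]
  exact (Complex.le_def.1 (hA.dotProduct_mulVec_nonneg h)).1

theorem rank_vecMulVec_eq_one {u v : n → ℂ} (h : vecMulVec u v ≠ 0) : (vecMulVec u v).rank = 1 := by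
  classical
  refine le_antisymm (rank_vecMulVec_le _ _) (Nat.one_le_iff_ne_zero.2 fun h0 => h ?_)
  rw [rank, Submodule.finrank_eq_zero, LinearMap.range_eq_bot] at h0
  exact toLin'.injective (by rw [toLin'_apply', h0, map_zero])

theorem PosSemidef.norm_apply_le_trace {A : Matrix n n ℂ} (hA : A.PosSemidef) (i j : n) :
    ‖A i j‖ ≤ A.trace.re := by
  classical
  open scoped MatrixOrder in
  obtain ⟨B, rfl⟩ := CStarAlgebra.nonneg_iff_eq_star_mul_self.1 hA.nonneg
  have htr : (star B * B).trace.re = ∑ l, ∑ m, ‖B m l‖ ^ 2 := by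
    simp [trace, mul_apply, star_apply, ← Complex.normSq_eq_norm_sq, Complex.normSq_apply]
  have hcol (l : n) : ∑ m, ‖B m l‖ ^ 2 ≤ (star B * B).trace.re := by
    rw [htr]
    exact Finset.single_le_sum (f := fun l => ∑ m, ‖B m l‖ ^ 2)
      (fun _ _ => Finset.sum_nonneg fun _ _ => sq_nonneg _) (Finset.mem_univ l)
  have hij : ‖(star B * B) i j‖ ≤ ∑ m, (‖B m i‖ ^ 2 + ‖B m j‖ ^ 2) / 2 := by
    rw [mul_apply]
    refine (norm_sum_le _ _).trans (Finset.sum_le_sum fun m _ => ?_)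
    rw [norm_mul, star_apply, norm_star]
    nlinarith [sq_nonneg (‖B m i‖ - ‖B m j‖)]
  rw [← Finset.sum_div, Finset.sum_add_distrib] at hij
  linarith [hcol i, hcol j]

theorem isClosed_setOf_posSemidef : IsClosed {A : Matrix n n ℂ | A.PosSemidef} := by
  simp only [posSemidef_iff_dotProduct_mulVec, IsHermitian, Set.ofPred_and, Set.ofPred_forall]
  refine (isClosed_eq (by fun_prop) continuous_id).inter (isClosed_iInter fun x => ?_)
  exact isClosed_le continuous_const (by fun_prop)

/-- The matrices with all entries bounded by `c`. -/
def entryBall (n : Type*) (c : ℝ) : Set (Matrix n n ℂ) :=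
  Set.univ.pi fun _ => Set.univ.pi fun _ => Metric.closedBall 0 c

theorem isCompact_entryBall (n : Type*) (c : ℝ) : IsCompact (entryBall n c) :=
  isCompact_univ_pi fun _ => isCompact_univ_pi fun _ => isCompact_closedBall _ _

theorem PosSemidef.mem_entryBall {A : Matrix n n ℂ} (hA : A.PosSemidef) {c : ℝ}
    (hc : A.trace.re ≤ c) : A ∈ entryBall n c := by
  intro i _ j _
  rw [mem_closedBall_zero_iff]
  exact (hA.norm_apply_le_trace i j).trans hc

/-- A positive semidefinite `A` dominates a matrix of rank at most one with the same value of the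
quadratic form at a given vector. -/
theorem PosSemidef.exists_rank_one_le {A : Matrix n n ℂ} (hA : A.PosSemidef) (h : n → ℂ) :
    ∃ B : Matrix n n ℂ, B.PosSemidef ∧ (A - B).PosSemidef ∧
      (vecMulVec h (star h) * B).trace = (vecMulVec h (star h) * A).trace ∧
      (B ≠ 0 → B.rank = 1) := by
  classical
  simp only [trace_vecMulVec_self_star_mul]
  set d : ℂ := star h ⬝ᵥ A *ᵥ h with hd
  have hd0 : 0 ≤ d := hA.dotProduct_mulVec_nonneg h
  by_cases hdz : d = 0
  · exact ⟨0, .zero, by simpa using hA, by simp [hdz], fun h => (h rfl).elim⟩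
  set v : n → ℂ := A *ᵥ h with hv
  have hdv : star d = d := Complex.conj_eq_iff_im.2 (Complex.le_def.1 hd0).2.symm
  have hvA : star h ᵥ* A = star v := by
    rw [hv, star_mulVec, hA.isHermitian.eq]
  have hvh : star v ⬝ᵥ h = d := by
    rw [← hvA, ← dotProduct_mulVec]
  refine ⟨d⁻¹ • vecMulVec v (star v), ?_, ?_, ?_, ?_⟩
  · exact (posSemidef_vecMulVec_self_star v).smul (inv_nonneg.2 hd0)
  · have key : A - d⁻¹ • vecMulVec v (star v) =
        (1 - d⁻¹ • vecMulVec h (star v))ᴴ * A * (1 - d⁻¹ • vecMulVec h (star v)) := by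
      have hT : (1 - d⁻¹ • vecMulVec h (star v))ᴴ = 1 - d⁻¹ • vecMulVec v (star h) := by
        rw [conjTranspose_sub, conjTranspose_smul, conjTranspose_vecMulVec, star_star, star_inv₀,
          hdv, conjTranspose_one]
      rw [hT, sub_mul, one_mul, smul_mul_assoc, vecMulVec_mul, hvA, mul_sub, mul_one,
        mul_smul_comm, sub_mul, smul_mul_assoc, vecMulVec_mul_vecMulVec, mul_vecMulVec, ← hv, hvh,
        vecMulVec_smul, smul_smul, inv_mul_cancel₀ hdz, one_smul, sub_self, smul_zero, sub_zero]
    rw [key]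
    exact hA.conjTranspose_mul_mul_same _
  · rw [smul_mulVec, vecMulVec_mulVec, hvh, dotProduct_smul]
    rw [op_smul_eq_smul, dotProduct_smul, ← hd, smul_eq_mul, smul_eq_mul, inv_mul_cancel_left₀ hdz]
  · intro hB
    rw [← smul_vecMulVec] at hB ⊢
    exact rank_vecMulVec_eq_one hB

end Matrix

namespace ISAC.Network

variable {M K N : ℕ} {net : Network M K N}

theorem crlbBlock_congr {x y : Vars M K N} {s : Fin (M + 1)} (hJ : x.J = y.J)
    (hcov : ∀ s', s' ≠ s → cov x s' = cov y s') : net.crlbBlock x s = net.crlbBlock y s := by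
  have h (m : Fin M) : cov x (s.succAbove m) = cov y (s.succAbove m) := hcov _ (s.succAbove_ne m)
  simp only [crlbBlock, Fpp, Fpα, Fαα, D, h, hJ]

theorem sum_crlbBlock_congr (hb : ∀ s, net.b s ∈ Set.Icc (0 : ℝ) 1)
    (hb_sum : ∑ s, (1 - net.b s) = 1) {x y : Vars M K N} (hJ : x.J = y.J)
    (hcov : ∀ s, net.b s ≠ 0 → cov x s = cov y s) :
    ∑ s, ((1 - net.b s : ℝ) : ℂ) • net.crlbBlock x s =
      ∑ s, ((1 - net.b s : ℝ) : ℂ) • net.crlbBlock y s := by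
  refine Finset.sum_congr rfl fun s _ => ?_
  rcases (hb s).2.eq_or_lt with h1 | h1
  · simp [h1]
  rw [crlbBlock_congr hJ]
  refine fun s' hs' => hcov s' fun h0 => ?_
  have := Finset.add_le_sum (s := Finset.univ) (f := fun s => 1 - net.b s)
    (fun i _ => sub_nonneg.2 (hb i).2) (Finset.mem_univ s') (Finset.mem_univ s) hs'
  simp only [hb_sum, h0] at this
  linarith

/-- Switch off the sensing signal of the purely receiving base stations. -/
noncomputable def muteReceivers (net : Network M K N) (x : Vars M K N) : Vars M K N :=
  { x with R := fun s => if net.b s = 0 then 0 else x.R s }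

theorem objective_muteReceivers (x : Vars M K N) :
    net.objective (net.muteReceivers x) = net.objective x := by
  have h (s) : net.b s * ((net.muteReceivers x).R s).trace.re = net.b s * (x.R s).trace.re := by
    by_cases hs : net.b s = 0 <;> simp [muteReceivers, hs]
  simp only [objective, h]
  rfl

theorem RelaxedFeasible.muteReceivers {𝒜 : Set ℝ} (hb : ∀ s, net.b s ∈ Set.Icc (0 : ℝ) 1)
    (hb_sum : ∑ s, (1 - net.b s) = 1) {x : Vars M K N} (hx : net.RelaxedFeasible 𝒜 x) :
    net.RelaxedFeasible 𝒜 (net.muteReceivers x) where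
  W_psd := hx.W_psd
  R_psd s := by
    by_cases hs : net.b s = 0
    · simpa [Network.muteReceivers, hs] using Matrix.PosSemidef.zero
    · simpa [Network.muteReceivers, hs] using hx.R_psd s
  C1 s := by
    have := hx.C1 s
    by_cases hs : net.b s = 0 <;> simpa [Network.muteReceivers, hs] using this
  C2a := hx.C2a
  C2b := hx.C2b
  C2c := by
    rw [sum_crlbBlock_congr (x := net.muteReceivers x) (y := x) hb hb_sum rfl]
    · exact hx.C2c
    · intro s hs
      simp [cov, Network.muteReceivers, hs]
  C3 k := by
    have h (s) : net.b s * (net.H s k * (net.muteReceivers x).R s).trace.re =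
        net.b s * (net.H s k * x.R s).trace.re := by
      by_cases hs : net.b s = 0 <;> simp [Network.muteReceivers, hs]
    simp only [h]
    exact hx.C3 k
  C4 := hx.C4
  C6 := hx.C6
  C7 := hx.C7
  C10a := hx.C10a
  C10b := hx.C10b
  C10c := hx.C10c
  C10d := hx.C10d

theorem RelaxedFeasible.exists_signal_pos {𝒜 : Set ℝ} {x : Vars M K N}
    (hx : net.RelaxedFeasible 𝒜 x) (hσc : ∀ k, 0 < net.σc k) (hΓ : ∀ k, 0 < net.Γ k)
    (hb : ∀ s, 0 ≤ net.b s) (k : Fin K) : ∃ s, 0 < (net.H s k * x.Wt s k).trace.re := by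
  by_contra! hneg
  have h1 : 1 / net.Γ k * ∑ s, (net.H s k * x.Wt s k).trace.re ≤ 0 :=
    mul_nonpos_of_nonneg_of_nonpos (one_div_nonneg.2 (hΓ k).le)
      (Finset.sum_nonpos fun s _ => hneg s)
  have h2 : 0 ≤ ∑ s, net.b s * (net.H s k * x.R s).trace.re :=
    Finset.sum_nonneg fun s _ => mul_nonneg (hb s) ((hx.R_psd s).trace_vecMulVec_mul_re_nonneg _)
  have h3 : 0 ≤ ∑ s, ∑ k' ∈ Finset.univ.erase k, (net.H s k * x.Wt s k').trace.re :=
    Finset.sum_nonneg fun s _ => Finset.sum_nonneg fun k' _ =>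
      (hx.C10d s k').trace_vecMulVec_mul_re_nonneg _
  have := hx.C3 k
  have := pow_pos (hσc k) 2
  linarith

/-- A beamformer with a positive signal part carries a positive association weight. -/
theorem RelaxedFeasible.a_mul_P_pos {𝒜 : Set ℝ} {x : Vars M K N} (hx : net.RelaxedFeasible 𝒜 x)
    {s : Fin (M + 1)} {k : Fin K} (h : 0 < (net.H s k * x.Wt s k).trace.re) :
    0 < x.a s k * net.P := by
  by_contra! hle
  have h1 : (-(((x.a s k * net.P : ℝ) : ℂ) • (1 : Matrix (Fin N) (Fin N) ℂ))).PosSemidef := by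
    rw [← neg_smul]
    refine Matrix.PosSemidef.one.smul ?_
    rw [← Complex.ofReal_neg, Complex.zero_le_real]
    linarith
  have h2 := ((hx.C10a s k).add h1).trace_vecMulVec_mul_re_nonneg (net.h s k)
  rw [show ((x.a s k * net.P : ℝ) : ℂ) • (1 : Matrix (Fin N) (Fin N) ℂ) - x.Wt s k
    + -(((x.a s k * net.P : ℝ) : ℂ) • (1 : Matrix (Fin N) (Fin N) ℂ)) = -x.Wt s k by abel,
    mul_neg, Matrix.trace_neg, Complex.neg_re] at h2
  unfold H at h
  linarith

theorem RelaxedFeasible.exists_rank_one {𝒜 : Set ℝ} (h𝒜 : 𝒜 ⊆ Set.Icc 0 1)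
    (hσc : ∀ k, 0 < net.σc k) (hΓ : ∀ k, 0 < net.Γ k)
    (hb : ∀ s, net.b s ∈ Set.Icc (0 : ℝ) 1) (hb_sum : ∑ s, (1 - net.b s) = 1)
    {x : Vars M K N} (hx : net.RelaxedFeasible 𝒜 x) :
    ∃ y, net.RelaxedFeasible 𝒜 y ∧ net.objective y ≤ net.objective x ∧
      ∀ s k, (y.W s k).rank = 1 := by
  choose B hBpsd hsub hBtr hBrank using fun s k => (hx.C10d s k).exists_rank_one_le (net.h s k)
  have ha0 (s k) : 0 ≤ x.a s k := (h𝒜 (hx.C7 s k)).1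
  have ha1 (s k) : x.a s k ≤ 1 := (h𝒜 (hx.C7 s k)).2
  have hW (s k) : ∃ W : Matrix (Fin N) (Fin N) ℂ, W.PosSemidef ∧ W.rank = 1 ∧
      (W - B s k).PosSemidef ∧
      (B s k - (W - (((1 - x.a s k) * net.P : ℝ) : ℂ) • (1 : Matrix (Fin N) (Fin N) ℂ))).PosSemidef
      := by
    obtain ⟨s₀, hs₀⟩ := hx.exists_signal_pos hσc hΓ (fun s => (hb s).1) k
    have hP : 0 < net.P := pos_of_mul_pos_right (hx.a_mul_P_pos hs₀) (ha0 _ _)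
    have ha₀ : 0 < x.a s₀ k := pos_of_mul_pos_left (hx.a_mul_P_pos hs₀) hP.le
    have hc : 0 ≤ (1 - x.a s k) * net.P := mul_nonneg (sub_nonneg.2 (ha1 s k)) hP.le
    by_cases hB : B s k = 0
    · have hlt : x.a s k < 1 := by
        have hne : s₀ ≠ s := by
          rintro rfl
          have := hBtr s₀ k
          rw [hB] at this
          unfold H at hs₀
          simp [← this] at hs₀
        have := Finset.add_le_sum (s := Finset.univ) (f := fun s => x.a s k)
          (fun i _ => ha0 i k) (Finset.mem_univ s₀) (Finset.mem_univ s) hne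
        simp only [hx.C4 k] at this
        linarith
      have hN : 0 < N := by
        rcases Nat.eq_zero_or_pos N with rfl | h
        · simp [Matrix.trace] at hs₀
        · exact h
      set e : Fin N → ℂ := Pi.single ⟨0, hN⟩ 1 with he
      have hee : Matrix.vecMulVec e (star e) = Matrix.diagonal e := by
        ext i j
        rw [Matrix.vecMulVec_apply, Matrix.diagonal_apply, he, Pi.star_apply, Pi.single_apply,
          Pi.single_apply]
        grind [star_one, star_zero]
      set c : ℂ := (((1 - x.a s k) * net.P : ℝ) : ℂ) with hcdef
      have hc0 : 0 ≤ c := Complex.zero_le_real.2 hc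
      have hcne : c ≠ 0 := Complex.ofReal_ne_zero.2 (mul_pos (sub_pos.2 hlt) hP).ne'
      have hpsd : (c • Matrix.vecMulVec e (star e)).PosSemidef :=
        (Matrix.posSemidef_vecMulVec_self_star e).smul hc0
      refine ⟨c • Matrix.vecMulVec e (star e), hpsd, ?_, by simpa [hB] using hpsd, ?_⟩
      · rw [← Matrix.smul_vecMulVec]
        refine Matrix.rank_vecMulVec_eq_one fun h => hcne ?_
        simpa [he, Matrix.vecMulVec_apply] using congrFun₂ h ⟨0, hN⟩ ⟨0, hN⟩
      · rw [hB, zero_sub, neg_sub, ← smul_sub, hee, ← Matrix.diagonal_one, Matrix.diagonal_sub]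
        refine (Matrix.PosSemidef.diagonal fun i => ?_).smul hc0
        by_cases hi : i = ⟨0, hN⟩ <;> simp [he, hi]
    · refine ⟨B s k, hBpsd s k, hBrank s k hB, by simpa using Matrix.PosSemidef.zero, ?_⟩
      rw [sub_sub_cancel]
      exact Matrix.PosSemidef.one.smul (Complex.zero_le_real.2 hc)
  choose W hWpsd hWrank hWB hBW using hW
  let y : Vars M K N :=
    { W := W, Wt := B, R := fun s => x.R s + ∑ k, (x.Wt s k - B s k), J := x.J, a := x.a }
  have hcov (s) : cov y s = cov x s := by
    simp only [cov, y, Finset.sum_sub_distrib]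
    abel
  have htr (s) : ∑ k, (B s k).trace.re + net.b s * (y.R s).trace.re ≤
      ∑ k, (x.Wt s k).trace.re + net.b s * (x.R s).trace.re := by
    have h0 : 0 ≤ (∑ k, (x.Wt s k - B s k)).trace.re :=
      (Matrix.posSemidef_sum _ fun k _ => hsub s k).trace_re_nonneg
    have h1 : (∑ k, (x.Wt s k - B s k)).trace.re =
        ∑ k, (x.Wt s k).trace.re - ∑ k, (B s k).trace.re := by
      simp [Matrix.trace_sum, Complex.re_sum]
    have h2 := mul_le_of_le_one_left h0 (hb s).2
    simp only [y, Matrix.trace_add, Complex.add_re, mul_add]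
    linarith
  refine ⟨y, ?_, ?_, hWrank⟩
  · refine ⟨hWpsd, fun s => (hx.R_psd s).add (Matrix.posSemidef_sum _ fun k _ => hsub s k),
      fun s => (htr s).trans (hx.C1 s), hx.C2a, hx.C2b, ?_, fun k => (hx.C3 k).trans ?_, hx.C4,
      hx.C6, hx.C7, fun s k => ?_, hBW, hWB, hBpsd⟩
    · rw [sum_crlbBlock_congr (x := y) (y := x) hb hb_sum rfl fun s _ => hcov s]
      exact hx.C2c
    · have hself (s) : (net.H s k * B s k).trace.re = (net.H s k * x.Wt s k).trace.re :=
        congrArg Complex.re (hBtr s k)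
      have hint (s) : net.b s * (net.H s k * y.R s).trace.re +
          ∑ k' ∈ Finset.univ.erase k, (net.H s k * B s k').trace.re ≤
          net.b s * (net.H s k * x.R s).trace.re +
          ∑ k' ∈ Finset.univ.erase k, (net.H s k * x.Wt s k').trace.re := by
        set δ : Fin K → ℝ := fun k' => (net.H s k * (x.Wt s k' - B s k')).trace.re with hδ
        have hδ0 (k') : 0 ≤ δ k' := (hsub s k').trace_vecMulVec_mul_re_nonneg _
        have hδk : δ k = 0 := by
          simp only [hδ, Matrix.mul_sub, Matrix.trace_sub, Complex.sub_re, hself, sub_self]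
        have h1 : (net.H s k * y.R s).trace.re = (net.H s k * x.R s).trace.re +
            ∑ k' ∈ Finset.univ.erase k, δ k' := by
          rw [Finset.sum_erase _ hδk]
          simp only [y, hδ, Matrix.mul_add, Matrix.mul_sum, Matrix.trace_add, Matrix.trace_sum,
            Complex.add_re, Complex.re_sum]
        have h2 : ∑ k' ∈ Finset.univ.erase k, δ k' =
            ∑ k' ∈ Finset.univ.erase k, (net.H s k * x.Wt s k').trace.re -
            ∑ k' ∈ Finset.univ.erase k, (net.H s k * B s k').trace.re := by
          simp [hδ, Matrix.mul_sub]
        have h3 := mul_le_of_le_one_left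
          (Finset.sum_nonneg fun k' (_ : k' ∈ Finset.univ.erase k) => hδ0 k') (hb s).2
        rw [h1, mul_add]
        linarith
      have := Finset.sum_le_sum fun s (_ : s ∈ Finset.univ) => hint s
      simp only [Finset.sum_add_distrib] at this
      simp only [y, hself] at this ⊢
      linarith
    · have := (hx.C10a s k).add (hsub s k)
      rwa [sub_add_sub_cancel] at this
  · have := Finset.sum_le_sum fun s (_ : s ∈ Finset.univ) => htr s
    simp only [Finset.sum_add_distrib] at this
    unfold objective
    linarith

end ISAC.Network

namespace ISAC

/-- The space of tuples `(W, W̃, R, a, J, B)`; the matrix `B` stands for the inverse of `J`. -/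
abbrev VarSpace (M K N : ℕ) : Type :=
  (Fin (M + 1) → Fin K → Matrix (Fin N) (Fin N) ℂ) ×
  (Fin (M + 1) → Fin K → Matrix (Fin N) (Fin N) ℂ) ×
  (Fin (M + 1) → Matrix (Fin N) (Fin N) ℂ) ×
  (Fin (M + 1) → Fin K → ℝ) ×
  Matrix (Fin 2) (Fin 2) ℂ × Matrix (Fin 2) (Fin 2) ℂ

namespace VarSpace

variable {M K N : ℕ}

/-- The optimization variables described by a tuple. -/
def toVars (e : VarSpace M K N) : Vars M K N where
  W := e.1
  Wt := e.2.1
  R := e.2.2.1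
  a := e.2.2.2.1
  J := e.2.2.2.2.1

/-- The last component of a tuple. -/
def inv (e : VarSpace M K N) : Matrix (Fin 2) (Fin 2) ℂ := e.2.2.2.2.2

@[fun_prop]
theorem continuous_inv : Continuous (inv : VarSpace M K N → _) := by
  unfold inv; fun_prop

@[fun_prop]
theorem continuous_W (s : Fin (M + 1)) (k : Fin K) :
    Continuous fun e : VarSpace M K N => e.toVars.W s k := by
  unfold toVars; fun_prop

@[fun_prop]
theorem continuous_Wt (s : Fin (M + 1)) (k : Fin K) :
    Continuous fun e : VarSpace M K N => e.toVars.Wt s k :=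
  (continuous_apply_apply s k).comp (continuous_fst.comp continuous_snd)

@[fun_prop]
theorem continuous_R (s : Fin (M + 1)) : Continuous fun e : VarSpace M K N => e.toVars.R s :=
  (continuous_apply s).comp (continuous_fst.comp (continuous_snd.comp continuous_snd))

@[fun_prop]
theorem continuous_a (s : Fin (M + 1)) (k : Fin K) :
    Continuous fun e : VarSpace M K N => e.toVars.a s k := by
  unfold toVars; fun_prop

@[fun_prop]
theorem continuous_J : Continuous fun e : VarSpace M K N => e.toVars.J := by
  unfold toVars; fun_prop

@[fun_prop]
theorem continuous_cov (s : Fin (M + 1)) :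
    Continuous fun e : VarSpace M K N => Network.cov e.toVars s := by
  unfold Network.cov; fun_prop

@[fun_prop]
theorem continuous_Fpp (net : Network M K N) (s : Fin (M + 1)) :
    Continuous fun e : VarSpace M K N => net.Fpp e.toVars s := by
  unfold Network.Fpp
  refine continuous_matrix fun i j => ?_
  simp only [Matrix.of_apply]
  fun_prop

@[fun_prop]
theorem continuous_crlbBlock (net : Network M K N) (s : Fin (M + 1)) :
    Continuous fun e : VarSpace M K N => net.crlbBlock e.toVars s := by
  have hD : Continuous fun e : VarSpace M K N => net.D e.toVars s := by
    unfold Network.D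
    refine continuous_matrix fun i j => ?_
    simp only [Matrix.of_apply]
    fun_prop
  have hpα : Continuous fun e : VarSpace M K N => net.Fpα e.toVars s := by
    unfold Network.Fpα
    refine continuous_matrix fun i j => ?_
    simp only [Matrix.of_apply]
    fun_prop
  have hαα : Continuous fun e : VarSpace M K N => net.Fαα e.toVars s := by
    unfold Network.Fαα
    refine continuous_matrix fun i j => ?_
    simp only [Matrix.smul_apply, Matrix.kroneckerMap_apply, Matrix.diagonal_apply]
    split_ifs <;> fun_prop
  unfold Network.crlbBlock
  exact (((continuous_Fpp net s).matrix_map Complex.continuous_ofReal).sub continuous_J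
    ).matrix_fromBlocks (hpα.matrix_map Complex.continuous_ofReal)
    (hpα.matrix_transpose.matrix_map Complex.continuous_ofReal)
    (hαα.matrix_map Complex.continuous_ofReal)

@[fun_prop]
theorem continuous_objective (net : Network M K N) :
    Continuous fun e : VarSpace M K N => net.objective e.toVars := by
  unfold Network.objective; fun_prop

end VarSpace

namespace Network

variable {M K N : ℕ} (net : Network M K N)

/-- Feasible tuples with silent receivers, where the last component is the inverse of `J`. -/
def liftedSet (𝒜 : Set ℝ) : Set (VarSpace M K N) :=
  {e | net.RelaxedFeasible 𝒜 e.toVars ∧ (∀ s, net.b s = 0 → e.toVars.R s = 0) ∧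
    e.inv.PosSemidef ∧ e.inv.trace.re ≤ net.ε ∧ e.toVars.J * e.inv = 1}

variable {net} {𝒜 : Set ℝ}

theorem isClosed_liftedSet (h𝒜 : IsClosed 𝒜) : IsClosed (net.liftedSet 𝒜) := by
  have hpsd {ι : Type} [Fintype ι] {f : VarSpace M K N → Matrix ι ι ℂ} (hf : Continuous f) :
      IsClosed {e | (f e).PosSemidef} := Matrix.isClosed_setOf_posSemidef.preimage hf
  have hset : net.liftedSet 𝒜 =
      (⋂ s, ⋂ k, {e | (e.toVars.W s k).PosSemidef}) ∩
      (⋂ s, {e | (e.toVars.R s).PosSemidef}) ∩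
      (⋂ s, {e | ∑ k, (e.toVars.Wt s k).trace.re + net.b s * (e.toVars.R s).trace.re ≤ net.P}) ∩
      {e | e.toVars.J.PosSemidef} ∩
      {e | (∑ s, ((1 - net.b s : ℝ) : ℂ) • net.crlbBlock e.toVars s).PosSemidef} ∩
      (⋂ k, {e | net.σc k ^ 2 ≤ 1 / net.Γ k * ∑ s, (net.H s k * e.toVars.Wt s k).trace.re
        - ∑ s, net.b s * (net.H s k * e.toVars.R s).trace.re
        - ∑ s, ∑ k' ∈ Finset.univ.erase k, (net.H s k * e.toVars.Wt s k').trace.re}) ∩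
      (⋂ k, {e | ∑ s, e.toVars.a s k = 1}) ∩
      (⋂ s, ⋂ k, {e | e.toVars.a s k ≤ net.b s}) ∩
      (⋂ s, ⋂ k, {e | e.toVars.a s k ∈ 𝒜}) ∩
      (⋂ s, ⋂ k, {e | (((e.toVars.a s k * net.P : ℝ) : ℂ) • (1 : Matrix (Fin N) (Fin N) ℂ)
        - e.toVars.Wt s k).PosSemidef}) ∩
      (⋂ s, ⋂ k, {e | (e.toVars.Wt s k - (e.toVars.W s k
        - (((1 - e.toVars.a s k) * net.P : ℝ) : ℂ) •
          (1 : Matrix (Fin N) (Fin N) ℂ))).PosSemidef}) ∩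
      (⋂ s, ⋂ k, {e | (e.toVars.W s k - e.toVars.Wt s k).PosSemidef}) ∩
      (⋂ s, ⋂ k, {e | (e.toVars.Wt s k).PosSemidef}) ∩
      (⋂ s, ⋂ (_ : net.b s = 0), {e | e.toVars.R s = 0}) ∩
      {e | e.inv.PosSemidef} ∩ {e | e.inv.trace.re ≤ net.ε} ∩ {e | e.toVars.J * e.inv = 1} := by
    ext e
    simp only [liftedSet, Set.mem_inter_iff, Set.mem_iInter, Set.mem_ofPred_eq]
    constructor
    · rintro ⟨⟨h1, h2, h3, -, h5, h6, h7, h8, h9, h10, h11, h12, h13, h14⟩, h15, h16, h17, h18⟩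
      tauto
    · rintro ⟨⟨⟨⟨⟨⟨⟨⟨⟨⟨⟨⟨⟨⟨⟨⟨h1, h2⟩, h3⟩, h5⟩, h6⟩, h7⟩, h8⟩, h9⟩, h10⟩, h11⟩, h12⟩, h13⟩, h14⟩,
        h15⟩, h16⟩, h17⟩, h18⟩
      refine ⟨⟨h1, h2, h3, ⟨?_, ?_⟩, h5, h6, h7, h8, h9, h10, h11, h12, h13, h14⟩, h15, h16, h17,
        h18⟩
      · exact (Matrix.isUnit_iff_isUnit_det _).1 (IsUnit.of_mul_eq_one _ h18)
      · rwa [Matrix.inv_eq_right_inv h18]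
  rw [hset]
  repeat' first
    | exact hpsd (by fun_prop)
    | refine IsClosed.inter ?_ ?_
    | refine isClosed_iInter fun _ => ?_
    | exact isClosed_le (by fun_prop) (by fun_prop)
    | exact isClosed_eq (by fun_prop) (by fun_prop)
    | exact h𝒜.preimage (VarSpace.continuous_a _ _)

theorem RelaxedFeasible.trace_Wt_le {x : Vars M K N} (h𝒜 : 𝒜 ⊆ Set.Icc 0 1)
    (hx : net.RelaxedFeasible 𝒜 x) (s : Fin (M + 1)) (k : Fin K) :
    (x.Wt s k).trace.re ≤ |net.P| * N := by
  have h := (hx.C10a s k).trace_re_nonneg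
  simp only [Matrix.trace_sub, Matrix.trace_smul, Matrix.trace_one, Fintype.card_fin, smul_eq_mul,
    Complex.sub_re, Complex.re_ofReal_mul, Complex.natCast_re] at h
  have ha := h𝒜 (hx.C7 s k)
  have h1 : x.a s k * net.P ≤ |net.P| :=
    (mul_le_mul_of_nonneg_left (le_abs_self _) ha.1).trans
      (mul_le_of_le_one_left (abs_nonneg _) ha.2)
  have h2 := mul_le_mul_of_nonneg_right h1 (Nat.cast_nonneg (α := ℝ) N)
  linarith

theorem RelaxedFeasible.trace_W_le {x : Vars M K N} (h𝒜 : 𝒜 ⊆ Set.Icc 0 1)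
    (hx : net.RelaxedFeasible 𝒜 x) (s : Fin (M + 1)) (k : Fin K) :
    (x.W s k).trace.re ≤ 2 * (|net.P| * N) := by
  have h := (hx.C10b s k).trace_re_nonneg
  simp only [Matrix.trace_sub, Matrix.trace_smul, Matrix.trace_one, Fintype.card_fin, smul_eq_mul,
    Complex.sub_re, Complex.re_ofReal_mul, Complex.natCast_re] at h
  have ha := h𝒜 (hx.C7 s k)
  have h1 : (1 - x.a s k) * net.P ≤ |net.P| :=
    (mul_le_mul_of_nonneg_left (le_abs_self _) (sub_nonneg.2 ha.2)).trans
      (mul_le_of_le_one_left (abs_nonneg _) (sub_le_self _ ha.1))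
  have h2 := mul_le_mul_of_nonneg_right h1 (Nat.cast_nonneg (α := ℝ) N)
  linarith [hx.trace_Wt_le h𝒜 s k]

theorem RelaxedFeasible.trace_R_le {x : Vars M K N} (hx : net.RelaxedFeasible 𝒜 x)
    {s : Fin (M + 1)} (hb : 0 < net.b s) : (x.R s).trace.re ≤ net.P / net.b s := by
  rw [le_div_iff₀' hb]
  have h0 : 0 ≤ ∑ k, (x.Wt s k).trace.re :=
    Finset.sum_nonneg fun k _ => (hx.C10d s k).trace_re_nonneg
  linarith [hx.C1 s]

theorem RelaxedFeasible.trace_J_le {x : Vars M K N} (hx : net.RelaxedFeasible 𝒜 x)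
    (hb_sum : ∑ s, (1 - net.b s) = 1) :
    x.J.trace.re ≤ ∑ s, (1 - net.b s) * (net.Fpp x s).trace := by
  have h := (hx.C2c.submatrix Sum.inl).trace_re_nonneg
  have heq : ((∑ s, ((1 - net.b s : ℝ) : ℂ) • net.crlbBlock x s).submatrix
      (Sum.inl : Fin 2 → _) Sum.inl).trace.re =
      ∑ s, (1 - net.b s) * ((net.Fpp x s).trace - x.J.trace.re) := by
    simp only [Matrix.trace, Matrix.diag_apply, Matrix.submatrix_apply, Matrix.sum_apply,
      Matrix.smul_apply, crlbBlock, Matrix.fromBlocks_apply₁₁, Matrix.sub_apply, Matrix.map_apply,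
      smul_eq_mul, Complex.re_sum, Complex.re_ofReal_mul, Complex.sub_re, Complex.ofReal_re]
    rw [Finset.sum_comm]
    simp only [← Finset.mul_sum, Finset.sum_sub_distrib]
  rw [heq] at h
  simp only [mul_sub, Finset.sum_sub_distrib, ← Finset.sum_mul, hb_sum, one_mul] at h
  linarith

theorem isCompact_liftedSet (h𝒜c : IsClosed 𝒜) (h𝒜 : 𝒜 ⊆ Set.Icc 0 1)
    (hb : ∀ s, 0 ≤ net.b s) (hb_sum : ∑ s, (1 - net.b s) = 1) :
    IsCompact (net.liftedSet 𝒜) := by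
  let box (c c' : ℝ) : Set (VarSpace M K N) :=
    (Set.univ.pi fun _ => Set.univ.pi fun _ => Matrix.entryBall (Fin N) (2 * (|net.P| * N))) ×ˢ
    (Set.univ.pi fun _ => Set.univ.pi fun _ => Matrix.entryBall (Fin N) (|net.P| * N)) ×ˢ
    (Set.univ.pi fun s => Matrix.entryBall (Fin N) (net.P / net.b s)) ×ˢ
    (Set.univ.pi fun _ => Set.univ.pi fun _ => Set.Icc 0 1) ×ˢ
    Matrix.entryBall (Fin 2) c ×ˢ Matrix.entryBall (Fin 2) c'
  have hbox (c c' : ℝ) : IsCompact (box c c') :=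
    (isCompact_univ_pi fun _ => isCompact_univ_pi fun _ => Matrix.isCompact_entryBall _ _).prod <|
    (isCompact_univ_pi fun _ => isCompact_univ_pi fun _ => Matrix.isCompact_entryBall _ _).prod <|
    (isCompact_univ_pi fun _ => Matrix.isCompact_entryBall _ _).prod <|
    (isCompact_univ_pi fun _ => isCompact_univ_pi fun _ => isCompact_Icc).prod <|
    (Matrix.isCompact_entryBall _ _).prod (Matrix.isCompact_entryBall _ _)
  have hmem {e : VarSpace M K N} (he : e ∈ net.liftedSet 𝒜) {c c' : ℝ}
      {J B : Matrix (Fin 2) (Fin 2) ℂ} (hJ : J ∈ Matrix.entryBall (Fin 2) c)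
      (hB : B ∈ Matrix.entryBall (Fin 2) c') :
      (e.1, e.2.1, e.2.2.1, e.2.2.2.1, J, B) ∈ box c c' := by
    obtain ⟨hx, hR, -⟩ := he
    refine ⟨fun s _ k _ => (hx.W_psd s k).mem_entryBall (hx.trace_W_le h𝒜 s k),
      fun s _ k _ => (hx.C10d s k).mem_entryBall (hx.trace_Wt_le h𝒜 s k),
      fun s _ => (hx.R_psd s).mem_entryBall ?_, fun s _ k _ => h𝒜 (hx.C7 s k), hJ, hB⟩
    rcases (hb s).eq_or_lt with h0 | h0
    · simp [hR s h0.symm, ← h0]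
    · exact hx.trace_R_le h0
  have hf : Continuous fun e : VarSpace M K N => ∑ s, (1 - net.b s) * (net.Fpp e.toVars s).trace := by
    fun_prop
  obtain ⟨c, hc⟩ := (hbox 0 0).bddAbove_image hf.continuousOn
  refine (hbox c net.ε).of_isClosed_subset (isClosed_liftedSet h𝒜c) fun e he => ?_
  refine hmem he (he.1.C2b.mem_entryBall ?_) (he.2.2.1.mem_entryBall he.2.2.2.1)
  refine (he.1.trace_J_le hb_sum).trans (hc ⟨_, hmem he (J := 0) (B := 0) ?_ ?_, rfl⟩) <;>
    exact Matrix.PosSemidef.zero.mem_entryBall (by simp)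

theorem exists_isMinOn_relaxedSet (h𝒜c : IsClosed 𝒜) (h𝒜 : 𝒜 ⊆ Set.Icc 0 1)
    (hb : ∀ s, net.b s ∈ Set.Icc (0 : ℝ) 1) (hb_sum : ∑ s, (1 - net.b s) = 1)
    (hfeas : (net.relaxedSet 𝒜).Nonempty) :
    ∃ x ∈ net.relaxedSet 𝒜, IsMinOn net.objective (net.relaxedSet 𝒜) x := by
  have hlift (x : Vars M K N) (hx : x ∈ net.relaxedSet 𝒜) :
      ∃ e ∈ net.liftedSet 𝒜, net.objective e.toVars = net.objective x := by
    let y := net.muteReceivers x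
    have hy : net.RelaxedFeasible 𝒜 y := RelaxedFeasible.muteReceivers hb hb_sum hx
    refine ⟨(y.W, y.Wt, y.R, y.a, y.J, y.J⁻¹), ⟨hy, fun s hs => ?_, hy.C2b.inv, hy.C2a.2,
      Matrix.mul_nonsing_inv _ hy.C2a.1⟩, objective_muteReceivers x⟩
    simp [VarSpace.toVars, y, muteReceivers, hs]
  obtain ⟨x₀, hx₀⟩ := hfeas
  obtain ⟨e₀, he₀, -⟩ := hlift x₀ hx₀
  obtain ⟨e, he, hmin⟩ := (isCompact_liftedSet h𝒜c h𝒜 (fun s => (hb s).1) hb_sum).exists_isMinOn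
    ⟨e₀, he₀⟩ (VarSpace.continuous_objective net).continuousOn
  refine ⟨e.toVars, he.1, fun x hx => ?_⟩
  obtain ⟨e', he', heq⟩ := hlift x hx
  exact (hmin he').trans_eq heq

end Network

end ISAC

theorem theorem1 {M K N : ℕ} (net : ISAC.Network M K N) (𝒜 : Set ℝ)
    (h𝒜 : 𝒜 = {0, 1} ∨ 𝒜 = Set.Icc 0 1)
    (hσc : ∀ k, 0 < net.σc k) (hσr : ∀ s, 0 < net.σr s) (hΓ : ∀ k, 0 < net.Γ k)
    (hθr : ∀ s, DifferentiableAt ℝ (net.θr s) net.p)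
    (hθt : ∀ s, DifferentiableAt ℝ (net.θt s) net.p)
    (hτ : ∀ s s', DifferentiableAt ℝ (net.τ s s') net.p)
    (hb : ∀ s, net.b s ∈ Set.Icc (0 : ℝ) 1) (hb_sum : ∑ s, (1 - net.b s) = 1)
    (hfeas : (net.relaxedSet 𝒜).Nonempty) :
    ∃ x ∈ net.relaxedSet 𝒜,
      IsMinOn net.objective (net.relaxedSet 𝒜) x ∧
      (∀ s k, (x.W s k).rank = 1) ∧
      x ∈ net.rankSet 𝒜 ∧ IsMinOn net.objective (net.rankSet 𝒜) x := by
  have hclosed : IsClosed 𝒜 := by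
    rcases h𝒜 with rfl | rfl
    · exact (Set.toFinite _).isClosed
    · exact isClosed_Icc
  have hsub : 𝒜 ⊆ Set.Icc 0 1 := by
    rcases h𝒜 with rfl | rfl
    · rintro a (rfl | rfl) <;> simp
    · exact subset_rfl
  obtain ⟨x, hx, hmin⟩ :=
    ISAC.Network.exists_isMinOn_relaxedSet hclosed hsub hb hb_sum hfeas
  obtain ⟨y, hy, hle, hrank⟩ :=
    ISAC.Network.RelaxedFeasible.exists_rank_one hsub hσc hΓ hb hb_sum hx
  have hymin : IsMinOn net.objective (net.relaxedSet 𝒜) y := fun z hz => hle.trans (hmin hz)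
  exact ⟨y, hy, hymin, hrank, ⟨hy, fun s k => (hrank s k).le⟩,
    hymin.on_subset fun z hz => hz.1⟩
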